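/- **Setting.** Let $d\in\mathbb N$ and let $\mathcal H$ be a complex Hilbert space; inner products are conjugate linear in the first argument. Let $\mathbb F^d$ be the free monoid on $d$ letters with unit $\emptyset$, let $F^2_d\otimes\mathcal H=\ell^2(\mathbb F^d,\mathcal H)$, whose elements are written $x=\sum_\alpha L^\alpha 1\otimes x_\alpha$, and let $L_j$ ($1\le j\le d$) be the left free shifts, $(L_j\otimes I)(L^\alpha1\otimes h)=L^{j\alpha}1\otimes h$. Let $\mathbb B^d_n$ be the set of $d$-tuples $Z=(Z_1,\dots,Z_d)$ of complex $n\times n$ matrices with $\|(Z_1,\dots,Z_d):\mathbb C^n\otimes\mathbb C^d\to\mathbb C^n\|<1$, and $\mathbb B^d_{\mathbb N}=\bigsqcup_n\mathbb B^d_n$. For a word $\alpha=i_1\cdots i_k$ put $Z^\alpha=Z_{i_1}\cdots Z_{i_k}$. Each $x\in F^2_d\otimes\mathcal H$ is regarded as the free function $x(Z)=\sum_\alpha Z^\alpha\otimes x_\alpha\in\mathbb C^{n\times n}\otimes\mathcal H$ on $\mathbb B^d_{\mathbb N}$. An element $A$ of the right free Schur class $\mathscr R_d(\mathcal H)$ is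 given by a free function $A^\dagger(Z)\in\mathbb C^{n\times n}\otimes\mathcal L(\mathcal H)$ on $\mathbb B^d_{\mathbb N}$ (that is, one respecting the grading and intertwinings) such that right multiplication by it, $(Ax)(Z)_{ik}=\sum_l A^\dagger(Z)_{lk}\,x(Z)_{il}$, defines a contraction $A$ on $F^2_d\otimes\mathcal H$. Write $A(0)=A^\dagger(0)\in\mathcal L(\mathcal H)$ for the value at $0\in\mathbb B^d_1$. With $K(Z,W)[P]=\sum_\alpha Z^\alpha P\,(W^\alpha)^*$, set $$K^A(Z,W)[P]=K(Z,W)[P]\otimes I_{\mathcal H}-(K(Z,W)\otimes I_{\mathcal H})\big[A^\dagger(Z)(P\otimes I_{\mathcal H})A^\dagger(W)^*\big].$$ The right free de Branges–Rovnyak space $\mathscr H^R(A)$ is the noncommutative reproducing kernel Hilbert space of $K^A$: the Hilbert space of $\mathcal H$-valued free functions on $\mathbb B^d_{\mathbb N}$ which is the completion of the span of the kernel vectors $K^A\{Z,y,v\}g$ ($Z\in\mathbb B^d_n$; $y,v\in\mathbb C^n$; $g\in\mathcal H$) for $$\langle K^A\{Z,y,v\}g,\;K^A\{W,x,u\}f\rangle=\big(y\otimes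 g,\;K^A(Z,W)[vu^*]\,(x\otimes f)\big),$$ with $\langle K^A\{Z,y,v\}g,f\rangle=(y\otimes g,f(Z)v)$ for $f\in\mathscr H^R(A)$. Let $K_0^A:\mathcal H\to\mathscr H^R(A)$ be the adjoint of evaluation at $0\in\mathbb B^d_1$. For $F=(F_1,\dots,F_d)\in\mathscr H^R(A)\otimes\mathbb C^d$ write $Z\,F(Z)=\sum_{j}(Z_j\otimes I_{\mathcal H})F_j(Z)$. - A *contractive Gleason solution for $A$* is a linear map $\mathbf A:\mathcal H\to\mathscr H^R(A)\otimes\mathbb C^d$ with $Z\,(\mathbf A h)(Z)=A^\dagger(Z)h-I_n\otimes A(0)h$ for all $h\in\mathcal H$, all $n$ and all $Z\in\mathbb B^d_n$, which is bounded and satisfies $\mathbf A^*\mathbf A\le I_{\mathcal H}-A(0)^*A(0)$. - A *contractive Gleason solution for $\mathscr H^R(A)$* is a linear map $X:\mathscr H^R(A)\to\mathscr H^R(A)\otimes\mathbb C^d$ with $Z\,(Xf)(Z)=f(Z)-f(0_n)$ for all $f\in\mathscr H^R(A)$, all $n$ and all $Z\in\mathbb B^d_n$, which is bounded and satisfies $X^*X\le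 I-K_0^A(K_0^A)^*$. **Theorem.** Let $A\in\mathscr R_d(\mathcal H)$. 1. The map $\check{\mathbf A}=(L^*\otimes I_{\mathcal H})A$, $h\mapsto\big((L_j^*\otimes I_{\mathcal H})A(1\otimes h)\big)_{j=1}^d$, takes values in $\mathscr H^R(A)\otimes\mathbb C^d$, is a contractive Gleason solution for $A$, and is the only one. 2. Every element of $\mathscr H^R(A)$ is the free function of exactly one element of $F^2_d\otimes\mathcal H$. Under this identification $L_j^*\otimes I_{\mathcal H}$ maps $\mathscr H^R(A)$ into itself for each $j$, and $\check X=(L^*\otimes I_{\mathcal H})|_{\mathscr H^R(A)}$, $f\mapsto\big((L_j^*\otimes I_{\mathcal H})f\big)_{j=1}^d$, is a contractive Gleason solution for $\mathscr H^R(A)$, and is the only one. -/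

import Mathlib

noncomputable section

namespace FreeDBR

open scoped InnerProductSpace

/-! ### The noncommutative unit ball and the Fock space -/

/-- The row operator `(Z₁, …, Z_d) : ℂⁿ ⊗ ℂᵈ → ℂⁿ` of a `d`-tuple of `n × n` matrices. -/
def rowMatrix {d n : ℕ} (Z : Fin d → Matrix (Fin n) (Fin n) ℂ) :
    Matrix (Fin n) (Fin d × Fin n) ℂ :=
  Matrix.of fun i p => Z p.1 i p.2

open scoped Matrix.Norms.L2Operator in
/-- Level `n` of the noncommutative open unit ball: the `d`-tuples of `n × n` matrices that are
strict row contractions, for the operator norm between Euclidean spaces.  (Level `0` holds only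
the tuple of empty matrices; every condition below is vacuous there.) -/
def ncBall (d n : ℕ) : Set (Fin d → Matrix (Fin n) (Fin n) ℂ) :=
  {Z | ‖rowMatrix Z‖ < 1}

open scoped Matrix.Norms.L2Operator in
/-- The point `0ₙ` of the noncommutative ball. -/
instance {d n : ℕ} : Zero (ncBall d n) :=
  ⟨0, by
    change ‖(0 : Matrix (Fin n) (Fin d × Fin n) ℂ)‖ < 1
    rw [norm_zero]
    exact one_pos⟩

/-- The monomial `Z^α = Z_{i₁} ⋯ Z_{i_k}` for the word `α = i₁ ⋯ i_k`. -/
def wordEval {d n : ℕ} (Z : Fin d → Matrix (Fin n) (Fin n) ℂ) (α : FreeMonoid (Fin d)) :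
    Matrix (Fin n) (Fin n) ℂ :=
  FreeMonoid.lift Z α

/-- The Fock space `F²_d ⊗ E`, realised as `ℓ²(𝔽ᵈ, E)` over the free monoid `𝔽ᵈ`; the family
`x` stands for `∑_α L^α 1 ⊗ x_α`. -/
abbrev Fock (d : ℕ) (E : Type*) [NormedAddCommGroup E] : Type _ :=
  lp (fun _ : FreeMonoid (Fin d) => E) 2

section Shift

variable {d : ℕ} {E : Type*} [NormedAddCommGroup E]

/-- The coefficients of `L_k x`: the coefficient at `kβ` is `x_β`, and the coefficient at a word
that does not begin with the letter `k` is `0`. -/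
def shiftFun (k : Fin d) (x : FreeMonoid (Fin d) → E) : FreeMonoid (Fin d) → E :=
  Function.extend (fun β => FreeMonoid.of k * β) x 0

lemma of_mul_injective (k : Fin d) :
    Function.Injective (fun β : FreeMonoid (Fin d) => FreeMonoid.of k * β) :=
  fun _ _ h => mul_left_cancel h

lemma shiftFun_of_mul (k : Fin d) (x : FreeMonoid (Fin d) → E) (β : FreeMonoid (Fin d)) :
    shiftFun k x (FreeMonoid.of k * β) = x β :=
  (of_mul_injective k).extend_apply x 0 β

lemma shiftFun_of_not (k : Fin d) (x : FreeMonoid (Fin d) → E) (α : FreeMonoid (Fin d))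
    (h : ¬ ∃ β, FreeMonoid.of k * β = α) : shiftFun k x α = 0 :=
  Function.extend_apply' _ _ _ h

lemma hasSum_shiftFun (k : Fin d) (x : Fock d E) :
    HasSum (fun α => ‖shiftFun k x α‖ ^ 2) (‖x‖ ^ 2) := by
  have h0 : HasSum (fun β => ‖x β‖ ^ 2) (‖x‖ ^ 2) := by
    simpa using lp.hasSum_norm (p := 2) (by norm_num) x
  refine ((of_mul_injective k).hasSum_iff ?_).1 ?_
  · intro α hα
    rw [shiftFun_of_not k _ α (by simpa using hα)]
    simp
  · convert h0 using 2 with β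
    exact congrArg (fun z => ‖z‖ ^ 2) (shiftFun_of_mul k (x : FreeMonoid (Fin d) → E) β)

variable [InnerProductSpace ℂ E]

/-- The left free shift `L_k ⊗ I_E`, an isometry of `F²_d ⊗ E`: `e_β ⊗ h ↦ e_{kβ} ⊗ h`. -/
def leftShift (k : Fin d) : Fock d E →ₗᵢ[ℂ] Fock d E where
  toFun x := ⟨shiftFun k x, by
    refine (memℓp_gen_iff (by norm_num)).2 ?_
    simpa using (hasSum_shiftFun k x).summable⟩
  map_add' x y := by
    refine Subtype.ext (funext fun α => ?_)
    change shiftFun k (fun β => x β + y β) α = shiftFun k x α + shiftFun k y α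
    by_cases h : ∃ β, FreeMonoid.of k * β = α
    · obtain ⟨β, rfl⟩ := h
      simp only [shiftFun_of_mul]
    · simp only [shiftFun_of_not k _ _ h, add_zero]
  map_smul' c x := by
    refine Subtype.ext (funext fun α => ?_)
    change shiftFun k (fun β => c • x β) α = c • shiftFun k x α
    by_cases h : ∃ β, FreeMonoid.of k * β = α
    · obtain ⟨β, rfl⟩ := h
      simp only [shiftFun_of_mul]
    · simp only [shiftFun_of_not k _ _ h, smul_zero]
  norm_map' x := by
    set y : Fock d E := ⟨shiftFun k x, _⟩ with hy
    have h1 : HasSum (fun β => ‖y β‖ ^ 2) (‖y‖ ^ 2) := by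
      simpa using lp.hasSum_norm (p := 2) (by norm_num) y
    have h2 := h1.unique (hasSum_shiftFun k x)
    exact (sq_eq_sq₀ (norm_nonneg _) (norm_nonneg _)).1 h2

/-- The backward left shift `L_k^* ⊗ I_E`. -/
def leftShiftAdj [CompleteSpace E] (k : Fin d) : Fock d E →L[ℂ] Fock d E :=
  ContinuousLinearMap.adjoint (leftShift k).toContinuousLinearMap

open scoped Classical in
/-- The vector `1 ⊗ h`, where `1` is the vacuum vector. -/
def vacuum (h : E) : Fock d E := lp.single 2 (1 : FreeMonoid (Fin d)) h

end Shift

/-! ### Free functions and right multipliers -/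

/-- The value at `Z` of the free function of `x ∈ F²_d ⊗ E`: the matrix
`x(Z) = ∑_α Z^α ⊗ x_α` with entries in `E`, the series being absolutely convergent on the
noncommutative ball. -/
def fockEval {d n : ℕ} {E : Type*} [NormedAddCommGroup E] [NormedSpace ℂ E] (x : Fock d E) (Z : Fin d → Matrix (Fin n) (Fin n) ℂ) :
    Matrix (Fin n) (Fin n) E :=
  Matrix.of fun i k => ∑' α, wordEval Z α i k • x α

section Functions

variable {n m : ℕ} {E : Type*} [AddCommGroup E] [Module ℂ E]

/-- The product `(M ⊗ I_E) F` of a scalar matrix and a matrix with entries in `E`. -/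
def scalarMul (M : Matrix (Fin n) (Fin m) ℂ) {l : ℕ} (F : Matrix (Fin m) (Fin l) E) :
    Matrix (Fin n) (Fin l) E :=
  Matrix.of fun i k => ∑ j, M i j • F j k

/-- The product `F (M ⊗ I_E)` of a matrix with entries in `E` and a scalar matrix. -/
def mulScalar {l : ℕ} (F : Matrix (Fin n) (Fin m) E) (M : Matrix (Fin m) (Fin l) ℂ) :
    Matrix (Fin n) (Fin l) E :=
  Matrix.of fun i k => ∑ j, M j k • F i j

/-- A graded function on the noncommutative ball with values in matrices over `E` is free if it
respects intertwinings: `Z X = X W` implies `f(Z) X = X f(W)`. -/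
def IsFree {d : ℕ} (f : ∀ n, ncBall d n → Matrix (Fin n) (Fin n) E) : Prop :=
  ∀ (n m : ℕ) (Z : ncBall d n) (W : ncBall d m) (X : Matrix (Fin n) (Fin m) ℂ),
    (∀ j, Z.1 j * X = X * W.1 j) → mulScalar (f n Z) X = scalarMul X (f m W)

end Functions

section Multipliers

variable {H J : Type*} [NormedAddCommGroup H] [InnerProductSpace ℂ H]
  [NormedAddCommGroup J] [InnerProductSpace ℂ J]

/-- The right product `G •_R F`: on elementary tensors, `(g ⊗ T) •_R (f ⊗ h) = f g ⊗ T h`. -/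
def rightProd {n : ℕ} (G : Matrix (Fin n) (Fin n) (H →L[ℂ] J)) (F : Matrix (Fin n) (Fin n) H) :
    Matrix (Fin n) (Fin n) J :=
  Matrix.of fun i k => ∑ l, G l k (F i l)

/-- The right free Schur class `𝓡_d(H, J)`, the closed unit ball of the right free multipliers
from `F²_d ⊗ H` to `F²_d ⊗ J`.  An element `A` is a free function `A†(Z)` (here `symbol`), with
values in matrices over the bounded operators from `H` to `J`, such that right multiplication by
it is a contraction `M^R` (here `op`) from `F²_d ⊗ H` to `F²_d ⊗ J`. -/
structure RightSchur (d : ℕ) (H J : Type*) [NormedAddCommGroup H] [InnerProductSpace ℂ H]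
    [NormedAddCommGroup J] [InnerProductSpace ℂ J] where
  symbol : ∀ n, ncBall d n → Matrix (Fin n) (Fin n) (H →L[ℂ] J)
  respects : IsFree symbol
  op : Fock d H →L[ℂ] Fock d J
  norm_op_le : ‖op‖ ≤ 1
  eval_op : ∀ (x : Fock d H) (n : ℕ) (Z : ncBall d n),
    fockEval (op x) Z.1 = rightProd (symbol n Z) (fockEval x Z.1)

/-- The value `A(0)` at the origin of the first level. -/
def RightSchur.zeroValue {d : ℕ} (A : RightSchur d H J) : H →L[ℂ] J :=
  A.symbol 1 0 0 0

end Multipliers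

/-! ### The right free de Branges–Rovnyak kernel -/

section Kernel

/-- The free Szegő kernel `K(Z, W)[P] = ∑_α Z^α P (W^α)^*`, tensored with the identity of `E`. -/
def szego {d n m : ℕ} {E : Type*} [NormedAddCommGroup E] [NormedSpace ℂ E]
    (Z : Fin d → Matrix (Fin n) (Fin n) ℂ) (W : Fin d → Matrix (Fin m) (Fin m) ℂ)
    (P : Matrix (Fin n) (Fin m) E) : Matrix (Fin n) (Fin m) E :=
  Matrix.of fun i k =>
    ∑' α, ∑ l, ∑ p, (wordEval Z α i l * star (wordEval W α k p)) • P l p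

variable {d : ℕ} {H J : Type*} [NormedAddCommGroup H] [InnerProductSpace ℂ H] [CompleteSpace H]
  [NormedAddCommGroup J] [InnerProductSpace ℂ J] [CompleteSpace J]

/-- `A†(Z) (P ⊗ I_H) A†(W)^*`, a matrix over the bounded operators on `J`. -/
def RightSchur.sandwich (A : RightSchur d H J) {n m : ℕ} (Z : ncBall d n) (W : ncBall d m)
    (P : Matrix (Fin n) (Fin m) ℂ) : Matrix (Fin n) (Fin m) (J →L[ℂ] J) :=
  Matrix.of fun l p => ∑ a, ∑ b,
    P a b • (A.symbol n Z l a ∘L ContinuousLinearMap.adjoint (A.symbol m W p b))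

/-- The right free de Branges–Rovnyak kernel
`K^A(Z, W)[P] = K(Z, W)[P] ⊗ I_J - (K(Z, W) ⊗ I_J)[A†(Z) (P ⊗ I_H) A†(W)^*]`. -/
def RightSchur.ncKernel (A : RightSchur d H J) {n m : ℕ} (Z : ncBall d n) (W : ncBall d m)
    (P : Matrix (Fin n) (Fin m) ℂ) : Matrix (Fin n) (Fin m) (J →L[ℂ] J) :=
  szego Z.1 W.1 (P.map fun c => c • ContinuousLinearMap.id ℂ J) - szego Z.1 W.1 (A.sandwich Z W P)

/-- The labels `Z, y, v` of the kernel vectors `K{Z, y, v}`, with `Z` in level `n` of the ball and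
`y, v ∈ ℂⁿ`. -/
structure KernelIndex (d : ℕ) where
  n : ℕ
  Z : ncBall d n
  y : Fin n → ℂ
  v : Fin n → ℂ

/-- The Gram matrix of the kernel vectors: its entry at `(Z, y, v)`, `(W, x, u)` is the operator
`(y ⊗ I_J)^* K^A(Z, W)[v u^*] (x ⊗ I_J)` on `J`. -/
def RightSchur.gram (A : RightSchur d H J) :
    Matrix (KernelIndex d) (KernelIndex d) (J →L[ℂ] J) :=
  Matrix.of fun p q => ∑ i, ∑ k, (star (p.y i) * q.y k) •
    A.ncKernel p.Z q.Z (Matrix.vecMulVec p.v (star q.v)) i k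

/-! #### Positivity of the kernel -/

variable {E : Type*} [NormedAddCommGroup E] [InnerProductSpace ℂ E]

open scoped Matrix.Norms.L2Operator in
lemma row_bound {n : ℕ} (Z : ncBall d n) :
    ∃ r : ℝ, 0 ≤ r ∧ r < 1 ∧ ∀ w : Fin n → ℂ,
      ∑ j, ∑ k, ‖Matrix.vecMul w (Z.1 j) k‖ ^ 2 ≤ r * ∑ k, ‖w k‖ ^ 2 := by
  have hlt : ‖rowMatrix Z.1‖ < 1 := Z.2
  refine ⟨‖rowMatrix Z.1‖ ^ 2, by positivity, ?_, fun w => ?_⟩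
  · exact pow_lt_one₀ (norm_nonneg _) hlt two_ne_zero
  · have h := Matrix.l2_opNorm_mulVec (rowMatrix Z.1).conjTranspose
      (WithLp.toLp 2 (star w) : EuclideanSpace ℂ (Fin n))
    rw [Matrix.l2_opNorm_conjTranspose] at h
    have h2 := pow_le_pow_left₀ (norm_nonneg _) h 2
    rw [mul_pow, EuclideanSpace.norm_sq_eq, EuclideanSpace.norm_sq_eq] at h2
    have e1 : ∀ j k, ‖Matrix.vecMul w (Z.1 j) k‖ =
        ‖((rowMatrix Z.1).conjTranspose.mulVec (star w)) (j, k)‖ := by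
      intro j k
      rw [← norm_star]
      congr 1
      simp [Matrix.vecMul, Matrix.mulVec, dotProduct, rowMatrix, mul_comm]
    simp only [e1]
    rw [← Fintype.sum_prod_type'
      (f := fun j k => ‖((rowMatrix Z.1).conjTranspose.mulVec (star w)) (j, k)‖ ^ 2)]
    simpa using h2

lemma wordEval_ofFn_succ {n N : ℕ} (Z : Fin d → Matrix (Fin n) (Fin n) ℂ) (j : Fin d)
    (t : Fin N → Fin d) :
    wordEval Z (FreeMonoid.ofList (List.ofFn (Fin.cons j t : Fin (N + 1) → Fin d))) =
      Z j * wordEval Z (FreeMonoid.ofList (List.ofFn t)) := by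
  rw [List.ofFn_cons, FreeMonoid.ofList_cons]
  simp [wordEval]

lemma level_bound {n : ℕ} (Z : Fin d → Matrix (Fin n) (Fin n) ℂ) {r : ℝ} (h0 : 0 ≤ r)
    (hr : ∀ w : Fin n → ℂ,
      ∑ j, ∑ k, ‖Matrix.vecMul w (Z j) k‖ ^ 2 ≤ r * ∑ k, ‖w k‖ ^ 2) (N : ℕ) :
    ∀ w : Fin n → ℂ, ∑ t : Fin N → Fin d, ∑ k,
      ‖Matrix.vecMul w (wordEval Z (FreeMonoid.ofList (List.ofFn t))) k‖ ^ 2 ≤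
        r ^ N * ∑ k, ‖w k‖ ^ 2 := by
  induction N with
  | zero =>
    intro w
    simp [wordEval]
  | succ N ih =>
    intro w
    rw [← (Fin.consEquiv fun _ => Fin d).sum_comp, Fintype.sum_prod_type]
    calc _ = ∑ j, ∑ t : Fin N → Fin d, ∑ k, ‖Matrix.vecMul (Matrix.vecMul w (Z j))
            (wordEval Z (FreeMonoid.ofList (List.ofFn t))) k‖ ^ 2 := by
          refine Finset.sum_congr rfl fun j _ => Finset.sum_congr rfl fun t _ => ?_
          have := wordEval_ofFn_succ Z j t
          simp only [Fin.consEquiv, Equiv.coe_fn_mk, this, Matrix.vecMul_vecMul]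
      _ ≤ ∑ j, r ^ N * ∑ k, ‖Matrix.vecMul w (Z j) k‖ ^ 2 :=
          Finset.sum_le_sum fun j _ => ih _
      _ = r ^ N * ∑ j, ∑ k, ‖Matrix.vecMul w (Z j) k‖ ^ 2 := by rw [Finset.mul_sum]
      _ ≤ r ^ N * (r * ∑ k, ‖w k‖ ^ 2) := by gcongr; exact hr w
      _ = _ := by ring

/-- Square summability of the entries of the monomials at a point of the ball. -/
lemma summable_wordEval {n : ℕ} (Z : ncBall d n) (w : Fin n → ℂ) (k : Fin n) :
    Summable fun α => ‖Matrix.vecMul w (wordEval Z.1 α) k‖ ^ 2 := by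
  obtain ⟨r, h0, h1, hr⟩ := row_bound Z
  have key := level_bound Z.1 h0 hr
  let e : (Σ N, Fin N → Fin d) ≃ FreeMonoid (Fin d) :=
    List.equivSigmaTuple.symm.trans FreeMonoid.ofList
  rw [← e.summable_iff]
  refine (summable_sigma_of_nonneg fun _ => sq_nonneg _).2
    ⟨fun N => Summable.of_finite, ?_⟩
  refine Summable.of_nonneg_of_le (fun N => tsum_nonneg fun _ => sq_nonneg _) (fun N => ?_)
    ((summable_geometric_of_lt_one h0 h1).mul_right (∑ k, ‖w k‖ ^ 2))
  refine le_trans ?_ (key N w)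
  rw [tsum_fintype]
  refine Finset.sum_le_sum fun t _ => ?_
  exact Finset.single_le_sum (f := fun k => ‖Matrix.vecMul w (wordEval Z.1
    (FreeMonoid.ofList (List.ofFn t))) k‖ ^ 2) (fun _ _ => by positivity) (Finset.mem_univ k)

/-- The coefficients `(y^* Z^α)_l`. -/
def coeffFun {n : ℕ} (Z : ncBall d n) (y : Fin n → ℂ) (l : Fin n) (α : FreeMonoid (Fin d)) : ℂ :=
  Matrix.vecMul (star y) (wordEval Z.1 α) l

lemma memlp_coeff {n : ℕ} (Z : ncBall d n) (y : Fin n → ℂ) (l : Fin n) (g : E) :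
    Memℓp (fun α => star (coeffFun Z y l α) • g : FreeMonoid (Fin d) → E) 2 := by
  refine (memℓp_gen_iff (by norm_num)).2 ?_
  simpa [norm_smul, mul_pow, coeffFun] using
    (summable_wordEval Z (star y) l).mul_right (‖g‖ ^ 2)

/-- The map `g ↦ ∑_α conj((y^* Z^α)_l) L^α 1 ⊗ g`. -/
def coeffVec {n : ℕ} (Z : ncBall d n) (y : Fin n → ℂ) (l : Fin n) : E →L[ℂ] Fock d E :=
  LinearMap.mkContinuous
    { toFun := fun g => ⟨_, memlp_coeff Z y l g⟩
      map_add' := fun g h => Subtype.ext (funext fun α => smul_add _ _ _)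
      map_smul' := fun c g => Subtype.ext (funext fun α => smul_comm _ _ _) }
    (Real.sqrt (∑' α, ‖coeffFun Z y l α‖ ^ 2)) (fun g => by
      set x : Fock d E := ⟨_, memlp_coeff Z y l g⟩ with hx
      change ‖x‖ ≤ _
      refine (sq_le_sq₀ (norm_nonneg _) (by positivity)).1 ?_
      have h1 : HasSum (fun β => ‖x β‖ ^ 2) (‖x‖ ^ 2) := by
        simpa using lp.hasSum_norm (p := 2) (by norm_num) x
      rw [mul_pow, Real.sq_sqrt (tsum_nonneg fun _ => by positivity), ← tsum_mul_right,
        ← h1.tsum_eq]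
      refine le_of_eq (tsum_congr fun α => ?_)
      change ‖star (coeffFun Z y l α) • g‖ ^ 2 = _
      rw [norm_smul, mul_pow, norm_star])

lemma coeffVec_apply {n : ℕ} (Z : ncBall d n) (y : Fin n → ℂ) (l : Fin n) (g : E)
    (α : FreeMonoid (Fin d)) : coeffVec Z y l g α = star (coeffFun Z y l α) • g := rfl

variable [CompleteSpace E]

lemma summable_entry_smul {n : ℕ} (Z : ncBall d n) (x : Fock d E) (i k : Fin n) :
    Summable fun α => wordEval Z.1 α i k • x α := by
  have h0 : Summable fun α => ‖wordEval Z.1 α i k‖ ^ 2 := by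
    simpa [Matrix.single_one_vecMul] using summable_wordEval Z (Pi.single i 1) k
  have h1 : Summable (fun β => ‖x β‖ ^ 2) := by
    simpa using (lp.hasSum_norm (p := 2) (by norm_num) x).summable
  refine Summable.of_norm_bounded ((h0.add h1)) fun α => ?_
  rw [norm_smul]
  nlinarith [sq_nonneg (‖wordEval Z.1 α i k‖ - ‖x α‖), sq_nonneg (‖wordEval Z.1 α i k‖),
    sq_nonneg ‖x α‖]

/-- The adjoint of `coeffVec` is evaluation: `x ↦ (y^* x(Z))_l`. -/
lemma adjoint_coeffVec {n : ℕ} (Z : ncBall d n) (y : Fin n → ℂ) (l : Fin n) (x : Fock d E) :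
    ContinuousLinearMap.adjoint (coeffVec Z y l) x =
      ∑ i, star (y i) • fockEval x Z.1 i l := by
  refine ext_inner_left ℂ fun g => ?_
  rw [ContinuousLinearMap.adjoint_inner_right]
  have hs : HasSum (fun α => ∑ i, star (y i) • wordEval Z.1 α i l • x α)
      (∑ i, star (y i) • fockEval x Z.1 i l) :=
    hasSum_sum fun i _ => (summable_entry_smul Z x i l).hasSum.const_smul _
  have hs2 := hs.mapL (innerSL ℂ g)
  refine (lp.hasSum_inner (𝕜 := ℂ) (coeffVec Z y l g) x).unique ?_
  rw [innerSL_apply_apply] at hs2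
  convert hs2 using 2 with α
  rw [coeffVec_apply, inner_smul_left, innerSL_apply_apply]
  simp only [← mul_smul, ← Finset.sum_smul, inner_smul_right]
  simp [coeffFun, Matrix.vecMul, dotProduct]

lemma coeff_gram {n m : ℕ} (Z : ncBall d n) (W : ncBall d m) (y : Fin n → ℂ) (x : Fin m → ℂ)
    (l : Fin n) (p : Fin m) :
    ContinuousLinearMap.adjoint (coeffVec (E := E) Z y l) ∘L coeffVec W x p =
      (∑' α, coeffFun Z y l α * star (coeffFun W x p α)) • ContinuousLinearMap.id ℂ E := by
  ext g
  refine ext_inner_left ℂ fun h => ?_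
  rw [ContinuousLinearMap.comp_apply, ContinuousLinearMap.adjoint_inner_right, lp.inner_eq_tsum]
  simp only [coeffVec_apply, inner_smul_left, inner_smul_right, smul_apply,
    ContinuousLinearMap.id_apply, ← mul_assoc]
  rw [tsum_mul_right]
  congr 1
  refine tsum_congr fun α => ?_
  simp [mul_comm]

lemma szego_sum {F : Type*} [NormedAddCommGroup F] [NormedSpace ℂ F] {n m : ℕ}
    (Z : ncBall d n) (W : ncBall d m) (y : Fin n → ℂ) (x : Fin m → ℂ)
    (P : Matrix (Fin n) (Fin m) F) :
    ∑ i, ∑ k, (star (y i) * x k) • szego Z.1 W.1 P i k =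
      ∑ l, ∑ p, (∑' α, coeffFun Z y l α * star (coeffFun W x p α)) • P l p := by
  have hw : ∀ i l k p, Summable fun α => wordEval Z.1 α i l * star (wordEval W.1 α k p) := by
    intro i l k p
    have h0 : Summable fun α => ‖wordEval Z.1 α i l‖ ^ 2 := by
      simpa [Matrix.single_one_vecMul] using summable_wordEval Z (Pi.single i 1) l
    have h1 : Summable fun α => ‖wordEval W.1 α k p‖ ^ 2 := by
      simpa [Matrix.single_one_vecMul] using summable_wordEval W (Pi.single k 1) p
    refine Summable.of_norm_bounded (h0.add h1) fun α => ?_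
    rw [norm_mul, norm_star]
    nlinarith [sq_nonneg (‖wordEval Z.1 α i l‖ - ‖wordEval W.1 α k p‖),
      sq_nonneg (‖wordEval Z.1 α i l‖), sq_nonneg ‖wordEval W.1 α k p‖]
  have hk : ∀ i k, szego Z.1 W.1 P i k =
      ∑ l, ∑ p, (∑' α, wordEval Z.1 α i l * star (wordEval W.1 α k p)) • P l p := by
    intro i k
    refine HasSum.tsum_eq ?_
    exact hasSum_sum fun l _ => hasSum_sum fun p _ => (hw i l k p).hasSum.smul_const _
  have hc : ∀ l p, (∑' α, coeffFun Z y l α * star (coeffFun W x p α)) =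
      ∑ i, ∑ k, (star (y i) * x k) * ∑' α, wordEval Z.1 α i l * star (wordEval W.1 α k p) := by
    intro l p
    refine HasSum.tsum_eq ?_
    have : HasSum (fun α => ∑ i, ∑ k, (star (y i) * x k) *
        (wordEval Z.1 α i l * star (wordEval W.1 α k p))) (∑ i, ∑ k, (star (y i) * x k) *
          ∑' α, wordEval Z.1 α i l * star (wordEval W.1 α k p)) :=
      hasSum_sum fun i _ => hasSum_sum fun k _ => (hw i l k p).hasSum.mul_left _
    convert this using 2 with α
    simp only [coeffFun, Matrix.vecMul, dotProduct, star_sum, Finset.sum_mul_sum, star_mul',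
      Pi.star_apply, star_star]
    refine Finset.sum_congr rfl fun i _ => Finset.sum_congr rfl fun k _ => ?_
    ring
  simp only [hk, hc, Finset.smul_sum, Finset.sum_smul, ← mul_smul]
  calc _ = ∑ i, ∑ l, ∑ k, ∑ p, (star (y i) * x k *
          ∑' α, wordEval Z.1 α i l * star (wordEval W.1 α k p)) • P l p :=
        Finset.sum_congr rfl fun i _ => Finset.sum_comm
    _ = ∑ l, ∑ i, ∑ p, ∑ k, (star (y i) * x k *
          ∑' α, wordEval Z.1 α i l * star (wordEval W.1 α k p)) • P l p := by
        rw [Finset.sum_comm]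
        exact Finset.sum_congr rfl fun l _ => Finset.sum_congr rfl fun i _ => Finset.sum_comm
    _ = _ := Finset.sum_congr rfl fun l _ => Finset.sum_comm

/-- Evaluation `x ↦ (y^* ⊗ I) x(Z) v` on the Fock space. -/
def evalAt (p : KernelIndex d) : Fock d E →L[ℂ] E :=
  ∑ l, p.v l • ContinuousLinearMap.adjoint (coeffVec p.Z p.y l)

lemma adjoint_coeffVec_comp_op (A : RightSchur d H J) {n : ℕ} (Z : ncBall d n) (y : Fin n → ℂ)
    (l : Fin n) : ContinuousLinearMap.adjoint (coeffVec Z y l) ∘L A.op =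
      ∑ a, A.symbol n Z a l ∘L ContinuousLinearMap.adjoint (coeffVec Z y a) := by
  ext x
  simp only [ContinuousLinearMap.comp_apply, sum_apply, adjoint_coeffVec,
    A.eval_op, rightProd, Matrix.of_apply, map_sum, map_smul, Finset.smul_sum]
  exact Finset.sum_comm

/-- The operator `∑_l v_l A†(Z)_{al}`. -/
def symbolVec (A : RightSchur d H J) (p : KernelIndex d) (a : Fin p.n) : H →L[ℂ] J :=
  ∑ l, p.v l • A.symbol p.n p.Z a l

lemma evalAt_comp_op (A : RightSchur d H J) (p : KernelIndex d) :
    evalAt p ∘L A.op =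
      ∑ a, symbolVec A p a ∘L ContinuousLinearMap.adjoint (coeffVec p.Z p.y a) := by
  simp only [evalAt, symbolVec, ContinuousLinearMap.finsetSum_comp, ContinuousLinearMap.smul_comp,
    adjoint_coeffVec_comp_op, Finset.smul_sum]
  exact Finset.sum_comm

lemma sandwich_eq (A : RightSchur d H J) (p q : KernelIndex d) (l : Fin p.n) (m : Fin q.n) :
    A.sandwich p.Z q.Z (Matrix.vecMulVec p.v (star q.v)) l m =
      symbolVec A p l ∘L ContinuousLinearMap.adjoint (symbolVec A q m) := by
  simp only [RightSchur.sandwich, symbolVec, Matrix.of_apply, map_sum,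
    ContinuousLinearMap.finsetSum_comp, ContinuousLinearMap.comp_finsetSum,
    LinearIsometryEquiv.map_smulₛₗ, ContinuousLinearMap.smul_comp, ContinuousLinearMap.comp_smulₛₗ,
    Matrix.vecMulVec_apply, Pi.star_apply, mul_smul, Finset.smul_sum]
  rw [Finset.sum_comm]
  refine Finset.sum_congr rfl fun b _ => Finset.sum_congr rfl fun a _ => ?_
  exact smul_comm _ _ _

lemma gram_eq (A : RightSchur d H J) (p q : KernelIndex d) :
    A.gram p q = evalAt p ∘L
      (ContinuousLinearMap.id ℂ (Fock d J) - A.op ∘L ContinuousLinearMap.adjoint A.op) ∘L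
        ContinuousLinearMap.adjoint (evalAt q) := by
  have h1 : A.gram p q = (∑ l, ∑ m, (∑' α, coeffFun p.Z p.y l α * star (coeffFun q.Z q.y m α)) •
      ((p.v l * star (q.v m)) • ContinuousLinearMap.id ℂ J)) -
      ∑ l, ∑ m, (∑' α, coeffFun p.Z p.y l α * star (coeffFun q.Z q.y m α)) •
        (symbolVec A p l ∘L ContinuousLinearMap.adjoint (symbolVec A q m)) := by
    simp only [RightSchur.gram, RightSchur.ncKernel, Matrix.of_apply, Matrix.sub_apply, smul_sub,
      Finset.sum_sub_distrib, szego_sum, sandwich_eq, Matrix.map_apply, Matrix.vecMulVec_apply,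
      Pi.star_apply]
  have h2 : evalAt (E := J) p ∘L ContinuousLinearMap.adjoint (evalAt q) =
      ∑ l, ∑ m, (∑' α, coeffFun p.Z p.y l α * star (coeffFun q.Z q.y m α)) •
      ((p.v l * star (q.v m)) • ContinuousLinearMap.id ℂ J) := by
    simp only [evalAt, map_sum, ContinuousLinearMap.finsetSum_comp,
      ContinuousLinearMap.comp_finsetSum, LinearIsometryEquiv.map_smulₛₗ,
      ContinuousLinearMap.smul_comp, ContinuousLinearMap.comp_smul,
      ContinuousLinearMap.adjoint_adjoint, coeff_gram, Finset.smul_sum]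
    rw [Finset.sum_comm]
    refine Finset.sum_congr rfl fun l _ => Finset.sum_congr rfl fun m _ => ?_
    ext g
    simp [← mul_smul, mul_comm, mul_assoc, mul_left_comm]
  have h3 : (evalAt (E := J) p ∘L A.op) ∘L ContinuousLinearMap.adjoint (evalAt q ∘L A.op) =
      ∑ l, ∑ m, (∑' α, coeffFun p.Z p.y l α * star (coeffFun q.Z q.y m α)) •
        (symbolVec A p l ∘L ContinuousLinearMap.adjoint (symbolVec A q m)) := by
    simp only [evalAt_comp_op, map_sum, ContinuousLinearMap.finsetSum_comp,
      ContinuousLinearMap.comp_finsetSum, ContinuousLinearMap.adjoint_comp,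
      ContinuousLinearMap.adjoint_adjoint]
    rw [Finset.sum_comm]
    refine Finset.sum_congr rfl fun l _ => Finset.sum_congr rfl fun m _ => ?_
    rw [ContinuousLinearMap.comp_assoc, ← ContinuousLinearMap.comp_assoc _ (coeffVec q.Z q.y m),
      coeff_gram]
    ext g
    simp
  rw [h1, ← h2, ← h3, ContinuousLinearMap.adjoint_comp]
  ext g
  simp

/-- The kernel is positive: it is the kernel of a reproducing kernel Hilbert space. -/
theorem RightSchur.gram_posSemidef (A : RightSchur d H J) : A.gram.PosSemidef := by
  set T : Fock d J →L[ℂ] Fock d J :=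
    ContinuousLinearMap.id ℂ (Fock d J) - A.op ∘L ContinuousLinearMap.adjoint A.op with hT
  have hTpos : ∀ x, 0 ≤ RCLike.re ⟪T x, x⟫_ℂ := by
    intro x
    have h1 : ‖ContinuousLinearMap.adjoint A.op x‖ ≤ ‖x‖ := by
      refine ((ContinuousLinearMap.adjoint A.op).le_opNorm x).trans ?_
      rw [LinearIsometryEquiv.norm_map]
      exact mul_le_of_le_one_left (norm_nonneg _) A.norm_op_le
    have h2 : ⟪T x, x⟫_ℂ = ⟪x, x⟫_ℂ -
        ⟪ContinuousLinearMap.adjoint A.op x, ContinuousLinearMap.adjoint A.op x⟫_ℂ := by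
      rw [ContinuousLinearMap.adjoint_inner_right]
      simp [hT]
    rw [h2, map_sub, inner_self_eq_norm_sq, inner_self_eq_norm_sq]
    nlinarith [norm_nonneg (ContinuousLinearMap.adjoint A.op x)]
  have hTadj : ContinuousLinearMap.adjoint T = T := by
    simp [hT, ContinuousLinearMap.adjoint_comp, map_sub, ContinuousLinearMap.adjoint_id]
  have htfae := (RKHS.posSemidef_tfae (K := A.gram)).out 0 2
  refine htfae.2 ⟨?_, fun vv => ?_⟩
  · ext1 p q
    rw [Matrix.conjTranspose_apply, gram_eq, gram_eq, ContinuousLinearMap.star_eq_adjoint,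
      ContinuousLinearMap.adjoint_comp, ContinuousLinearMap.adjoint_comp,
      ContinuousLinearMap.adjoint_adjoint, ← hT, hTadj, ContinuousLinearMap.comp_assoc]
  · have : (vv.sum fun p w => vv.sum fun q w' => ⟪A.gram q p w, w'⟫_ℂ) =
        ⟪T (vv.sum fun p w => ContinuousLinearMap.adjoint (evalAt p) w),
          vv.sum fun p w => ContinuousLinearMap.adjoint (evalAt p) w⟫_ℂ := by
      simp only [gram_eq, ← hT, Finsupp.sum, map_sum, sum_inner, inner_sum,
        ContinuousLinearMap.comp_apply, ContinuousLinearMap.adjoint_inner_right]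
      exact Finset.sum_comm
    rw [this]
    exact hTpos _

instance (A : RightSchur d H J) : Fact A.gram.PosSemidef := ⟨A.gram_posSemidef⟩

/-! ### The de Branges–Rovnyak space and Gleason solutions -/

/-- The right free de Branges–Rovnyak space `𝓗^R(A)`: the Hilbert space completion of the span of
the kernel vectors `K^A{Z, y, v} g`, with the inner products
`⟪K^A{Z,y,v} g, K^A{W,x,u} f⟫ = (y ⊗ g, K^A(Z, W)[v u^*] (x ⊗ f))`. -/
def RightSchur.dBR (A : RightSchur d H J) : Type _ := RKHS.OfKernel A.gram

instance (A : RightSchur d H J) : NormedAddCommGroup A.dBR :=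
  inferInstanceAs (NormedAddCommGroup (RKHS.OfKernel A.gram))

instance (A : RightSchur d H J) : InnerProductSpace ℂ A.dBR :=
  inferInstanceAs (InnerProductSpace ℂ (RKHS.OfKernel A.gram))

instance (A : RightSchur d H J) : CompleteSpace A.dBR :=
  inferInstanceAs (CompleteSpace (RKHS.OfKernel A.gram))

instance (A : RightSchur d H J) : RKHS ℂ A.dBR (KernelIndex d) J :=
  inferInstanceAs (RKHS ℂ (RKHS.OfKernel A.gram) (KernelIndex d) J)

/-- The kernel of `𝓗^R(A)` is the prescribed one. -/
lemma RightSchur.kernel_dBR (A : RightSchur d H J) : RKHS.kernel A.dBR = A.gram :=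
  RKHS.OfKernel.kernel_ofKernel

/-- The value at `Z` of an element of `𝓗^R(A)`, a matrix with entries in `J`: its `(i, k)` entry
is given by pairing with the kernel vectors `K^A{Z, e_i, e_k} g`, `g ∈ J`. -/
def RightSchur.value (A : RightSchur d H J) (f : A.dBR) {n : ℕ} (Z : ncBall d n) :
    Matrix (Fin n) (Fin n) J :=
  Matrix.of fun i k => f ⟨n, Z, Pi.single i 1, Pi.single k 1⟩

lemma evalAt_apply (p : KernelIndex d) (x : Fock d J) :
    evalAt p x = ∑ l, ∑ i, (star (p.y i) * p.v l) • fockEval x p.Z.1 i l := by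
  simp only [evalAt, sum_apply, smul_apply, adjoint_coeffVec, Finset.smul_sum, ← mul_smul,
    mul_comm]

lemma evalAt_std (n : ℕ) (Z : ncBall d n) (i l : Fin n) (x : Fock d J) :
    evalAt ⟨n, Z, Pi.single i 1, Pi.single l 1⟩ x = fockEval x Z.1 i l := by
  rw [evalAt_apply]
  dsimp only
  rw [Finset.sum_eq_single l, Finset.sum_eq_single i]
  · simp
  · intro b _ hb; simp [hb]
  · simp
  · intro b _ hb; simp [hb]
  · simp

/-- The reproducing formula: evaluation at the index `(Z, y, v)` is `(y ⊗ I_J)^* f(Z) v`. -/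
lemma RightSchur.apply_eq_value (A : RightSchur d H J) (f : A.dBR) (p : KernelIndex d) :
    f p = ∑ l, ∑ i, (star (p.y i) * p.v l) • A.value f p.Z i l := by
  have hE : evalAt (E := J) p = ∑ l, ∑ i, (star (p.y i) * p.v l) •
      evalAt ⟨p.n, p.Z, Pi.single i 1, Pi.single l 1⟩ := by
    ext x
    simp only [sum_apply, smul_apply, evalAt_std, evalAt_apply p]
  refine ext_inner_left ℂ fun g => ?_
  have hk : RKHS.kerFun A.dBR p g = ∑ l, ∑ i, star (star (p.y i) * p.v l) •
      RKHS.kerFun A.dBR ⟨p.n, p.Z, Pi.single i 1, Pi.single l 1⟩ g := by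
    refine RKHS.ext fun q => ?_
    refine ext_inner_left ℂ fun g' => ?_
    rw [← RKHS.kerFun_inner, ← RKHS.kerFun_inner]
    simp only [inner_sum, inner_smul_right, RKHS.kerFun_inner, RKHS.kerFun_apply,
      RightSchur.kernel_dBR, gram_eq]
    rw [hE]
    simp only [map_sum, ContinuousLinearMap.comp_apply, sum_apply, smul_apply,
      inner_sum, map_smulₛₗ, inner_smul_right]
    simp
  rw [← RKHS.kerFun_inner, hk]
  simp only [sum_inner, inner_sum, inner_smul_left, inner_smul_right, RKHS.kerFun_inner,
    RightSchur.value, Matrix.of_apply]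
  simp

/-- `f ∈ 𝓗^R(A)` and `x ∈ F²_d ⊗ J` are the same free function on the noncommutative ball. -/
def RightSchur.SameFunction (A : RightSchur d H J) (f : A.dBR) (x : Fock d J) : Prop :=
  ∀ (n : ℕ) (Z : ncBall d n), A.value f Z = fockEval x Z.1

/-- `𝓗^R(A) ⊗ ℂᵈ`, the Hilbert space direct sum of `d` copies of `𝓗^R(A)`. -/
abbrev RightSchur.dBRd (A : RightSchur d H J) : Type _ := PiLp 2 (fun _ : Fin d => A.dBR)

/-- `Z F(Z) = ∑_j (Z_j ⊗ I_J) F_j(Z)` for `F = (F_1, …, F_d) ∈ 𝓗^R(A) ⊗ ℂᵈ`. -/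
def RightSchur.rowValue (A : RightSchur d H J) (F : A.dBRd) {n : ℕ} (Z : ncBall d n) :
    Matrix (Fin n) (Fin n) J :=
  ∑ j, scalarMul (Z.1 j) (A.value (F j) Z)

/-- The kernel map `K_0^A : J → 𝓗^R(A)` at the origin `0` of the first level, the adjoint of
evaluation at `0`. -/
def RightSchur.kernelZero (A : RightSchur d H J) : J →L[ℂ] A.dBR :=
  RKHS.kerFun A.dBR ⟨1, 0, 1, 1⟩

/-- `X` is a Gleason solution for `𝓗^R(A)`: `Z (X f)(Z) = f(Z) - f(0ₙ)`. -/
def RightSchur.IsGleasonSpace (A : RightSchur d H J) (X : A.dBR →ₗ[ℂ] A.dBRd) : Prop :=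
  ∀ (f : A.dBR) (n : ℕ) (Z : ncBall d n),
    A.rowValue (X f) Z = A.value f Z - A.value f (0 : ncBall d n)

/-- `X` is a contractive Gleason solution for `𝓗^R(A)`: moreover `X` is bounded and
`X^* X ≤ I - K_0^A (K_0^A)^*`. -/
def RightSchur.IsContractiveGleasonSpace (A : RightSchur d H J)
    (X : A.dBR →ₗ[ℂ] A.dBRd) : Prop :=
  A.IsGleasonSpace X ∧ ∃ T : A.dBR →L[ℂ] A.dBRd, (T : A.dBR →ₗ[ℂ] A.dBRd) = X ∧
    ContinuousLinearMap.adjoint T ∘L T ≤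
      ContinuousLinearMap.id ℂ A.dBR - A.kernelZero ∘L ContinuousLinearMap.adjoint A.kernelZero

/-- `Y` is a Gleason solution for `A`: `Z Y(Z) = A†(Z) - A(0) Iₙ`. -/
def RightSchur.IsGleason (A : RightSchur d H J) (Y : H →ₗ[ℂ] A.dBRd) : Prop :=
  ∀ (h : H) (n : ℕ) (Z : ncBall d n),
    A.rowValue (Y h) Z =
      (A.symbol n Z).map (fun T => T h) - Matrix.diagonal fun _ => A.zeroValue h

/-- `Y` is a contractive Gleason solution for `A`: moreover `Y` is bounded and
`Y^* Y ≤ I - A(0)^* A(0)`. -/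
def RightSchur.IsContractiveGleason (A : RightSchur d H J) (Y : H →ₗ[ℂ] A.dBRd) : Prop :=
  A.IsGleason Y ∧ ∃ T : H →L[ℂ] A.dBRd, (T : H →ₗ[ℂ] A.dBRd) = Y ∧
    ContinuousLinearMap.adjoint T ∘L T ≤
      ContinuousLinearMap.id ℂ H - ContinuousLinearMap.adjoint A.zeroValue ∘L A.zeroValue

/-- `X` is the restriction of `L^* ⊗ I_J` to `𝓗^R(A)`: every `f ∈ 𝓗^R(A)` is the free function of
exactly one `x ∈ F²_d ⊗ J`, and then `(X f)_j` is the free function of `(L_j^* ⊗ I_J) x`. -/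
def RightSchur.IsShiftRestriction (A : RightSchur d H J) (X : A.dBR →ₗ[ℂ] A.dBRd) : Prop :=
  (∀ f : A.dBR, ∃! x : Fock d J, A.SameFunction f x) ∧
    ∀ (f : A.dBR) (x : Fock d J), A.SameFunction f x →
      ∀ j, A.SameFunction (X f j) (leftShiftAdj j x)

/-- `Y` is `(L^* ⊗ I_J) A`: the component `(Y h)_j` is the free function of
`(L_j^* ⊗ I_J) A (1 ⊗ h)`. -/
def RightSchur.IsShiftSymbol (A : RightSchur d H J) (Y : H →ₗ[ℂ] A.dBRd) : Prop :=
  ∀ (h : H) (j : Fin d), A.SameFunction (Y h j) (leftShiftAdj j (A.op (vacuum h)))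

end Kernel

end FreeDBR

end

noncomputable section

namespace FreeDBR

open scoped InnerProductSpace

set_option linter.unusedSectionVars false

/-! Write `A` for `op`. The operator `compress` (`Q` below) sends Szegő kernel vectors to kernel
vectors of `𝓗^R(A)`. The kernel factors through `I - A A^*`, so `‖Q x‖² = ‖x‖² - ‖A^* x‖²`, and `Q`
is a contraction with dense range. Its adjoint `embed` preserves point evaluations, hence is the
inclusion of `𝓗^R(A)` in the Fock space. Free functions separate points of the Fock space
(`Fock.eq_of_fockEval_eq`), so the embedding is injective and the Fock representative is unique.

Uniqueness. Multiplication by `Z_j` is the shift `L_j`, so `Z F(Z) + g` is the free function of `∑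
L_j F_j + 1 ⊗ g`. The relations `L_k^* L_j = δ_{jk}` and `L_k^* (1 ⊗ g) = 0` recover each `F_k`.
Thus the Gleason equation alone forces `F_k = L_k^* x` (`rowValue_eq_iff`), with `x = f` or `x = A
(1 ⊗ h)`.

Existence. It must be shown that these backward shifts lie in `𝓗^R(A)` with the right bounds. Put `z
= ∑ L_j y_j + 1 ⊗ g`. A right multiplier commutes with left shifts, so `L_j^* A^* z = A^* y_j`;
splitting `‖z‖²` and `‖A^* z‖²` by first letter gives `‖Q z‖² + ‖(A^* z)_∅‖² = ∑ ‖Q y_j‖² + ‖g‖²`.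
Hence `((Q y_j)_j, g) ↦ (Q z, (A^* z)_∅)` extends to an isometry. Its adjoint `colligation` is a
contraction sending `(f, h)` to the backward shifts and the constant coefficient of `f + A (1 ⊗ h)`
(`colligation_eq`). Inputs `(f, 0)` and `(0, h)` give the two solutions, and contractivity gives
both operator inequalities. -/

/-! ### Separation of points of the Fock space -/

section Separation

variable {d : ℕ}

/-- The tuple of matrices indexed by the suffixes of a word `w`: the `j`-th matrix has an entry
`1` where deleting a leading letter `j` leads from one suffix to the next. -/
def suffixTuple (w : List (Fin d)) (j : Fin d) :
    Matrix (Fin (w.length + 1)) (Fin (w.length + 1)) ℂ :=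
  Matrix.of fun a b => if w.drop a = j :: w.drop b then 1 else 0

/-- Each factor strips one letter, so a product of factors strips a whole prefix. The entry from the
full word to the empty suffix therefore detects the single word `w`. -/
lemma wordEval_suffixTuple (w : List (Fin d)) (β : List (Fin d)) (a b : Fin (w.length + 1)) :
    wordEval (suffixTuple w) (FreeMonoid.ofList β) a b =
      if w.drop a = β ++ w.drop b then 1 else 0 := by
  induction β generalizing a with
  | nil =>
    have h : w.drop a = w.drop b ↔ a = b := by
      refine ⟨fun h => ?_, fun h => by rw [h]⟩
      have := congrArg List.length h
      simp only [List.length_drop] at this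
      omega
    simp [wordEval, Matrix.one_apply, h]
  | cons j β ih =>
    have h0 : wordEval (suffixTuple w) (FreeMonoid.ofList (j :: β)) =
        suffixTuple w j * wordEval (suffixTuple w) (FreeMonoid.ofList β) := by
      simp [wordEval, FreeMonoid.ofList_cons]
    rw [h0, Matrix.mul_apply]
    simp only [ih, suffixTuple, Matrix.of_apply]
    -- Comparing lengths, the only possible intermediate suffix starts at `a + 1`. At the last index
    -- the suffix is empty and nothing can be stripped.
    by_cases ha : (a : ℕ) < w.length
    · rw [Finset.sum_eq_single ⟨a + 1, by omega⟩]
      · have hd : w.drop a = w[(a : ℕ)] :: w.drop (a + 1) := List.drop_eq_getElem_cons ha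
        simp only [hd, List.cons_append, List.cons.injEq, and_true]
        by_cases hj : w[(a : ℕ)] = j <;> simp [hj]
      · intro m _ hm
        rw [if_neg, zero_mul]
        intro h
        have := congrArg List.length h
        simp only [List.length_drop, List.length_cons] at this
        exact hm (Fin.ext (by simp only; omega))
      · simp
    · have : w.drop a = [] := by simp; omega
      simp [this]

lemma wordEval_smul {n : ℕ} (r : ℂ) (Z : Fin d → Matrix (Fin n) (Fin n) ℂ) (β : List (Fin d)) :
    wordEval (r • Z) (FreeMonoid.ofList β) =
      r ^ β.length • wordEval Z (FreeMonoid.ofList β) := by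
  induction β with
  | nil => simp [wordEval]
  | cons j β ih =>
    have h0 : ∀ Y : Fin d → Matrix (Fin n) (Fin n) ℂ,
        wordEval Y (FreeMonoid.ofList (j :: β)) =
          Y j * wordEval Y (FreeMonoid.ofList β) := by
      intro Y
      simp [wordEval, FreeMonoid.ofList_cons]
    rw [h0, h0, ih]
    simp [pow_succ, smul_smul]

-- The suffix tuple need not be a strict row contraction. Rescaling moves it into the ball at the
-- cost of a nonzero power of `r` on each monomial.
open scoped Matrix.Norms.L2Operator in
lemma exists_smul_mem_ncBall {n : ℕ} (Z : Fin d → Matrix (Fin n) (Fin n) ℂ) :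
    ∃ r : ℂ, r ≠ 0 ∧ r • Z ∈ ncBall d n := by
  -- The `+ 1` makes the rescaled norm strictly less than one and also covers norm zero.
  have hpos : 0 < ‖rowMatrix Z‖ + 1 := by positivity
  refine ⟨((‖rowMatrix Z‖ + 1 : ℝ) : ℂ)⁻¹, ?_, ?_⟩
  · exact inv_ne_zero (by exact_mod_cast hpos.ne')
  · have h : ∀ c : ℂ, rowMatrix (c • Z) = c • rowMatrix Z := fun c => by
      ext i p
      simp [rowMatrix]
    change ‖rowMatrix _‖ < 1
    rw [h, norm_smul, norm_inv, Complex.norm_real, Real.norm_of_nonneg hpos.le,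
      inv_mul_lt_one₀ hpos]
    linarith

variable {E : Type*} [NormedAddCommGroup E] [InnerProductSpace ℂ E]

/-- An element of the Fock space is determined by its free function. -/
lemma Fock.eq_of_fockEval_eq {x y : Fock d E}
    (h : ∀ (n : ℕ) (Z : ncBall d n), fockEval x Z.1 = fockEval y Z.1) : x = y := by
  classical
  refine Subtype.ext (funext fun α => ?_)
  set w : List (Fin d) := FreeMonoid.toList α with hw
  obtain ⟨r, hr, hZ⟩ := exists_smul_mem_ncBall (suffixTuple w)
  -- The corner entry annihilates every term of the series except the one at `α`.
  have key : ∀ z : Fock d E,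
      fockEval z (r • suffixTuple w) 0 (Fin.last _) = r ^ w.length • z α := by
    intro z
    have hβ : ∀ β : FreeMonoid (Fin d),
        wordEval (r • suffixTuple w) β 0 (Fin.last _) = if α = β then r ^ w.length else 0 := by
      intro β
      rw [← FreeMonoid.ofList_toList β, wordEval_smul, Matrix.smul_apply, wordEval_suffixTuple]
      have : w.drop (0 : Fin (w.length + 1)) =
          FreeMonoid.toList β ++ w.drop (Fin.last w.length) ↔
          α = FreeMonoid.ofList (FreeMonoid.toList β) := by
        simp [hw]
      by_cases h1 : α = FreeMonoid.ofList (FreeMonoid.toList β)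
      · rw [if_pos (this.2 h1), if_pos h1, hw, h1]
        simp
      · rw [if_neg (mt this.1 h1), if_neg h1, smul_zero]
    simp only [fockEval, Matrix.of_apply, hβ]
    rw [tsum_eq_single α]
    · simp
    · intro β hne
      rw [if_neg hne.symm, zero_smul]
  have h1 := congrFun (congrFun (h _ ⟨_, hZ⟩) 0) (Fin.last _)
  simp only [key] at h1
  exact smul_right_injective E (pow_ne_zero _ hr) h1

end Separation

/-! ### Shifts and the vacuum -/

section Shifts

variable {d : ℕ} {E : Type*} [NormedAddCommGroup E] [InnerProductSpace ℂ E]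

lemma leftShift_apply_of_mul (k : Fin d) (x : Fock d E) (β : FreeMonoid (Fin d)) :
    leftShift k x (FreeMonoid.of k * β) = x β :=
  shiftFun_of_mul k x β

lemma leftShift_apply_of_ne {j k : Fin d} (h : j ≠ k) (x : Fock d E) (β : FreeMonoid (Fin d)) :
    leftShift j x (FreeMonoid.of k * β) = 0 :=
  shiftFun_of_not j x _ fun ⟨γ, hγ⟩ => h (by
    have := congrArg FreeMonoid.toList hγ
    simp only [FreeMonoid.toList_mul, FreeMonoid.toList_of, List.singleton_append,
      List.cons.injEq] at this
    exact this.1)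

lemma leftShift_apply_one (k : Fin d) (x : Fock d E) : leftShift k x 1 = 0 :=
  shiftFun_of_not k x _ fun ⟨γ, hγ⟩ => by
    have := congrArg FreeMonoid.toList hγ
    simp at this

lemma vacuum_apply_one (h : E) : (vacuum h : Fock d E) 1 = h := by
  simp [vacuum]

lemma vacuum_apply_of_mul (h : E) (k : Fin d) (β : FreeMonoid (Fin d)) :
    (vacuum h : Fock d E) (FreeMonoid.of k * β) = 0 := by
  classical
  rw [vacuum, lp.single_apply_ne]
  intro hγ
  have := congrArg FreeMonoid.toList hγ
  simp at this

open scoped Classical in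
lemma inner_single_left (β : FreeMonoid (Fin d)) (e : E) (x : Fock d E) :
    ⟪(lp.single 2 β e : Fock d E), x⟫_ℂ = ⟪e, x β⟫_ℂ :=
  lp.inner_single_left _ _ _

lemma inner_vacuum_left (h : E) (x : Fock d E) : ⟪(vacuum h : Fock d E), x⟫_ℂ = ⟪h, x 1⟫_ℂ :=
  inner_single_left 1 h x

variable [CompleteSpace E]

lemma fockEval_leftShift {n : ℕ} (k : Fin d) (x : Fock d E) (Z : ncBall d n) :
    fockEval (leftShift k x) Z.1 = scalarMul (Z.1 k) (fockEval x Z.1) := by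
  ext i l
  simp only [fockEval, scalarMul, Matrix.of_apply]
  have hs : HasSum (fun β => wordEval Z.1 (FreeMonoid.of k * β) i l • x β)
      (∑ j, Z.1 k i j • ∑' α, wordEval Z.1 α j l • x α) := by
    have := hasSum_sum (s := Finset.univ) fun j _ =>
      ((summable_entry_smul Z x j l).hasSum.const_smul (Z.1 k i j))
    convert this using 2 with β
    have h0 : wordEval Z.1 (FreeMonoid.of k * β) = Z.1 k * wordEval Z.1 β := by
      simp [wordEval]
    simp only [h0, Matrix.mul_apply, Finset.sum_smul, mul_smul]
  refine (((of_mul_injective k).hasSum_iff ?_).1 ?_).tsum_eq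
  · intro α hα
    have : leftShift k x α = 0 := shiftFun_of_not k x α (by simpa using hα)
    rw [this, smul_zero]
  · convert hs using 2 with β
    simp only [Function.comp_apply, leftShift_apply_of_mul]

lemma fockEval_vacuum {n : ℕ} (h : E) (Z : Fin d → Matrix (Fin n) (Fin n) ℂ) :
    fockEval (vacuum h) Z = Matrix.diagonal fun _ => h := by
  classical
  ext i l
  simp only [fockEval, Matrix.of_apply]
  rw [tsum_eq_single 1]
  · rw [vacuum_apply_one]
    by_cases hil : i = l
    · simp [hil, wordEval]
    · simp [hil, wordEval]
  · intro β hβ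
    rw [vacuum, lp.single_apply_ne _ _ _ hβ, smul_zero]

lemma fockEval_zero_point {n : ℕ} (x : Fock d E) :
    fockEval x (0 : ncBall d n).1 = Matrix.diagonal fun _ => x 1 := by
  ext i l
  simp only [fockEval, Matrix.of_apply]
  rw [tsum_eq_single 1]
  · by_cases hil : i = l
    · simp [hil, wordEval]
    · simp [hil, wordEval]
  · intro β hβ
    have h0 : wordEval (0 : ncBall d n).1 β = 0 := by
      induction β using FreeMonoid.casesOn with
      | one => exact absurd rfl hβ
      | of_mul j γ =>
        have : (0 : ncBall d n).1 j = 0 := rfl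
        simp [wordEval, this]
    simp [h0]

lemma leftShiftAdj_apply (k : Fin d) (x : Fock d E) (β : FreeMonoid (Fin d)) :
    leftShiftAdj k x β = x (FreeMonoid.of k * β) := by
  classical
  refine ext_inner_left ℂ fun e : E => ?_
  rw [← inner_single_left, leftShiftAdj, ContinuousLinearMap.adjoint_inner_right,
    ← inner_single_left]
  congr 1
  refine Subtype.ext (funext fun α => ?_)
  change shiftFun k (lp.single 2 β e : Fock d E) α = _
  by_cases h : ∃ γ, FreeMonoid.of k * γ = α
  · obtain ⟨γ, rfl⟩ := h
    rw [shiftFun_of_mul]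
    by_cases hγ : γ = β
    · simp [hγ]
    · rw [lp.single_apply_ne _ _ _ hγ, lp.single_apply_ne]
      exact fun h => hγ (mul_left_cancel h)
  · rw [shiftFun_of_not k _ _ h, lp.single_apply_ne]
    rintro rfl
    exact h ⟨β, rfl⟩

lemma leftShiftAdj_leftShift_self (k : Fin d) (x : Fock d E) :
    leftShiftAdj k (leftShift k x) = x :=
  Subtype.ext (funext fun β => by rw [leftShiftAdj_apply, leftShift_apply_of_mul])

lemma leftShiftAdj_leftShift_of_ne {j k : Fin d} (h : j ≠ k) (x : Fock d E) :
    leftShiftAdj k (leftShift j x) = 0 :=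
  Subtype.ext (funext fun β => by rw [leftShiftAdj_apply, leftShift_apply_of_ne h]; rfl)

lemma leftShiftAdj_vacuum (k : Fin d) (h : E) : leftShiftAdj k (vacuum h : Fock d E) = 0 :=
  Subtype.ext (funext fun β => by rw [leftShiftAdj_apply, vacuum_apply_of_mul]; rfl)

/-- `∑_j (L_j ⊗ I) y_j + 1 ⊗ g`. -/
def rowShift (y : Fin d → Fock d E) (g : E) : Fock d E :=
  ∑ j, leftShift j (y j) + vacuum g

/-- The shifts are isometries with mutually orthogonal ranges, all orthogonal to the vacuum vectors.
This rigidity is the source of uniqueness. -/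
lemma leftShiftAdj_rowShift (y : Fin d → Fock d E) (g : E) (k : Fin d) :
    leftShiftAdj k (rowShift y g) = y k := by
  rw [rowShift, map_add, map_sum, leftShiftAdj_vacuum, add_zero, Finset.sum_eq_single k,
    leftShiftAdj_leftShift_self]
  · exact fun j _ h => leftShiftAdj_leftShift_of_ne h _
  · simp

lemma rowShift_apply_one (y : Fin d → Fock d E) (g : E) : rowShift y g 1 = g := by
  rw [rowShift, lp.coeFn_add, Pi.add_apply, vacuum_apply_one, lp.coeFn_sum, Finset.sum_apply]
  simp [leftShift_apply_one]

/-- A nonempty word has a unique first letter, so the ranges of the shifts and the vacuum vectors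
exhaust the Fock space. -/
lemma rowShift_leftShiftAdj (x : Fock d E) :
    rowShift (fun j => leftShiftAdj j x) (x 1) = x := by
  refine Subtype.ext (funext fun α => ?_)
  induction α using FreeMonoid.casesOn with
  | one => exact rowShift_apply_one _ _
  | of_mul k β => rw [← leftShiftAdj_apply, leftShiftAdj_rowShift, leftShiftAdj_apply]

lemma inner_rowShift (y : Fin d → Fock d E) (g : E) (x : Fock d E) :
    ⟪rowShift y g, x⟫_ℂ = ∑ j, ⟪y j, leftShiftAdj j x⟫_ℂ + ⟪g, x 1⟫_ℂ := by
  rw [rowShift, inner_add_left, sum_inner, inner_vacuum_left]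
  congr 1
  refine Finset.sum_congr rfl fun j _ => ?_
  rw [leftShiftAdj, ContinuousLinearMap.adjoint_inner_right]
  rfl

lemma norm_sq_eq_sum_leftShiftAdj (x : Fock d E) :
    ‖x‖ ^ 2 = ∑ j, ‖leftShiftAdj j x‖ ^ 2 + ‖x 1‖ ^ 2 := by
  have h := inner_rowShift (fun j => leftShiftAdj j x) (x 1) x
  rw [rowShift_leftShiftAdj] at h
  simp only [inner_self_eq_norm_sq_to_K] at h
  exact_mod_cast h

lemma fockEval_rowShift {n : ℕ} (y : Fin d → Fock d E) (g : E) (Z : ncBall d n) :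
    fockEval (rowShift y g) Z.1 =
      ∑ j, scalarMul (Z.1 j) (fockEval (y j) Z.1) + Matrix.diagonal fun _ => g := by
  ext i l
  rw [← evalAt_std n Z i l, rowShift, map_add, map_sum]
  simp only [evalAt_std, fockEval_leftShift, fockEval_vacuum, Matrix.add_apply, Matrix.sum_apply]

end Shifts

/-! ### Right multipliers and the shifts -/

section Multiplier

variable {d : ℕ} {H J : Type*} [NormedAddCommGroup H] [InnerProductSpace ℂ H] [CompleteSpace H]
  [NormedAddCommGroup J] [InnerProductSpace ℂ J] [CompleteSpace J]

/-- A right multiplier commutes with the left shifts. -/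
lemma RightSchur.op_leftShift (A : RightSchur d H J) (k : Fin d) (x : Fock d H) :
    A.op (leftShift k x) = leftShift k (A.op x) := by
  refine Fock.eq_of_fockEval_eq fun n Z => ?_
  rw [A.eval_op, fockEval_leftShift, fockEval_leftShift, A.eval_op]
  ext i l
  -- `scalarMul` acts on the row index and `rightProd` on the column index, so the two finite sums
  -- can be exchanged.
  simp only [rightProd, scalarMul, Matrix.of_apply, map_sum, map_smul, Finset.smul_sum]
  exact Finset.sum_comm

lemma RightSchur.leftShiftAdj_adjoint_op (A : RightSchur d H J) (k : Fin d) (x : Fock d J) :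
    leftShiftAdj k (ContinuousLinearMap.adjoint A.op x) =
      ContinuousLinearMap.adjoint A.op (leftShiftAdj k x) := by
  refine ext_inner_left ℂ fun y => ?_
  simp only [leftShiftAdj, ContinuousLinearMap.adjoint_inner_right]
  exact congrArg (⟪·, x⟫_ℂ) (A.op_leftShift k y)

lemma RightSchur.fockEval_op_vacuum (A : RightSchur d H J) (h : H) {n : ℕ} (Z : ncBall d n) :
    fockEval (A.op (vacuum h)) Z.1 = (A.symbol n Z).map fun T => T h := by
  rw [A.eval_op, fockEval_vacuum]
  ext i l
  simp only [rightProd, Matrix.of_apply, Matrix.map_apply]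
  rw [Finset.sum_eq_single i]
  · simp
  · intro b _ hb
    simp [Matrix.diagonal_apply_ne' _ hb]
  · simp

lemma RightSchur.op_vacuum_apply_one (A : RightSchur d H J) (h : H) :
    A.op (vacuum h) 1 = A.zeroValue h := by
  have h1 := A.fockEval_op_vacuum h (0 : ncBall d 1)
  rw [fockEval_zero_point] at h1
  simpa [zeroValue] using congrFun (congrFun h1 0) 0

end Multiplier

/-! ### The embedding of `𝓗^R(A)` into the Fock space -/

section Embedding

variable {d : ℕ} {H J : Type*} [NormedAddCommGroup H] [InnerProductSpace ℂ H] [CompleteSpace H]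
  [NormedAddCommGroup J] [InnerProductSpace ℂ J] [CompleteSpace J]

lemma Fock.eq_of_evalAt_eq {x y : Fock d J} (h : ∀ p, evalAt p x = evalAt p y) : x = y := by
  refine Fock.eq_of_fockEval_eq fun n Z => ?_
  ext i l
  rw [← evalAt_std, ← evalAt_std, h]

/-- The linear combination `∑_p (evalAt p)^* g_p` of the Szegő kernel vectors. -/
def szegoCombination : (KernelIndex d →₀ J) →ₗ[ℂ] Fock d J :=
  Finsupp.lsum ℂ fun p => (ContinuousLinearMap.adjoint (evalAt (E := J) p)).toLinearMap

/-- The linear combination `∑_p K^A_p g_p` of the kernel vectors of `𝓗^R(A)`. -/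
def RightSchur.kernelCombination (A : RightSchur d H J) : (KernelIndex d →₀ J) →ₗ[ℂ] A.dBR :=
  Finsupp.lsum ℂ fun p => (RKHS.kerFun A.dBR p).toLinearMap

lemma szegoCombination_apply (v : KernelIndex d →₀ J) :
    szegoCombination v = v.sum fun p g => ContinuousLinearMap.adjoint (evalAt p) g := rfl

lemma RightSchur.kernelCombination_apply (A : RightSchur d H J) (v : KernelIndex d →₀ J) :
    A.kernelCombination v = v.sum fun p g => RKHS.kerFun A.dBR p g := rfl

lemma szegoCombination_single (p : KernelIndex d) (g : J) :
    szegoCombination (Finsupp.single p g) = ContinuousLinearMap.adjoint (evalAt p) g := by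
  simp [szegoCombination]

lemma RightSchur.kernelCombination_single (A : RightSchur d H J) (p : KernelIndex d) (g : J) :
    A.kernelCombination (Finsupp.single p g) = RKHS.kerFun A.dBR p g := by
  simp [kernelCombination]

/-- A vector orthogonal to all Szegő kernel vectors has zero free function, so it vanishes by
separation of points. -/
lemma denseRange_szegoCombination : DenseRange (szegoCombination : _ →ₗ[ℂ] Fock d J) := by
  have : (LinearMap.range (szegoCombination : _ →ₗ[ℂ] Fock d J)).topologicalClosure = ⊤ := by
    rw [Submodule.topologicalClosure_eq_top_iff, Submodule.eq_bot_iff]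
    intro x hx
    refine Fock.eq_of_evalAt_eq fun p => ext_inner_left ℂ fun g => ?_
    rw [map_zero, inner_zero_right, ← ContinuousLinearMap.adjoint_inner_left,
      ← szegoCombination_single]
    exact hx _ ⟨_, rfl⟩
  rw [DenseRange, ← LinearMap.coe_range]
  exact Submodule.dense_iff_topologicalClosure_eq_top.2 this

lemma RightSchur.denseRange_kernelCombination (A : RightSchur d H J) :
    DenseRange A.kernelCombination := by
  have : (LinearMap.range A.kernelCombination).topologicalClosure = ⊤ := by
    rw [Submodule.topologicalClosure_eq_top_iff, Submodule.eq_bot_iff]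
    intro f hf
    refine RKHS.ext fun p => ext_inner_left ℂ fun g => ?_
    rw [RKHS.coe_zero, Pi.zero_apply, inner_zero_right, ← RKHS.kerFun_inner,
      ← A.kernelCombination_single]
    exact hf _ ⟨_, rfl⟩
  rw [DenseRange, ← LinearMap.coe_range]
  exact Submodule.dense_iff_topologicalClosure_eq_top.2 this

/-- By `gram_eq` the Gram matrix is the form of `I - A A^*` evaluated on Szegő kernel vectors. -/
lemma RightSchur.inner_kernelCombination (A : RightSchur d H J) (v w : KernelIndex d →₀ J) :
    ⟪A.kernelCombination v, A.kernelCombination w⟫_ℂ =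
      ⟪(szegoCombination v : Fock d J), szegoCombination w⟫_ℂ -
        ⟪ContinuousLinearMap.adjoint A.op (szegoCombination v),
          ContinuousLinearMap.adjoint A.op (szegoCombination w)⟫_ℂ := by
  have h : ⟪A.kernelCombination v, A.kernelCombination w⟫_ℂ =
      ⟪szegoCombination v, (ContinuousLinearMap.id ℂ (Fock d J) -
        A.op ∘L ContinuousLinearMap.adjoint A.op) (szegoCombination w)⟫_ℂ := by
    simp only [kernelCombination_apply, szegoCombination_apply, Finsupp.sum, sum_inner, inner_sum,
      map_sum, RKHS.kerFun_inner, RKHS.kerFun_apply, A.kernel_dBR, gram_eq,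
      ContinuousLinearMap.comp_apply, ContinuousLinearMap.adjoint_inner_left]
  rw [h, ContinuousLinearMap.adjoint_inner_left]
  simp

/-- With the density above, this is the bound that lets `extendOfNorm` define `compress`; the
constant `1` is kept to match its hypothesis. -/
lemma RightSchur.norm_kernelCombination_le (A : RightSchur d H J) (v : KernelIndex d →₀ J) :
    ‖A.kernelCombination v‖ ≤ 1 * ‖(szegoCombination v : Fock d J)‖ := by
  have h := A.inner_kernelCombination v v
  simp only [inner_self_eq_norm_sq_to_K] at h
  have h' : ‖A.kernelCombination v‖ ^ 2 = ‖(szegoCombination v : Fock d J)‖ ^ 2 -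
      ‖ContinuousLinearMap.adjoint A.op (szegoCombination v)‖ ^ 2 := by exact_mod_cast h
  rw [one_mul, ← sq_le_sq₀ (norm_nonneg _) (norm_nonneg _), h']
  exact sub_le_self _ (sq_nonneg _)

/-- The contraction from the Fock space to `𝓗^R(A)` carrying the Szegő kernel vectors to the
kernel vectors of `𝓗^R(A)`. -/
def RightSchur.compress (A : RightSchur d H J) : Fock d J →L[ℂ] A.dBR :=
  A.kernelCombination.extendOfNorm szegoCombination

/-- The inclusion of `𝓗^R(A)` in the Fock space. -/
def RightSchur.embed (A : RightSchur d H J) : A.dBR →L[ℂ] Fock d J :=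
  ContinuousLinearMap.adjoint A.compress

lemma RightSchur.compress_szegoCombination (A : RightSchur d H J) (v : KernelIndex d →₀ J) :
    A.compress (szegoCombination v) = A.kernelCombination v :=
  LinearMap.extendOfNorm_eq denseRange_szegoCombination ⟨1, A.norm_kernelCombination_le⟩ v

lemma RightSchur.compress_adjoint_evalAt (A : RightSchur d H J) (p : KernelIndex d) (g : J) :
    A.compress (ContinuousLinearMap.adjoint (evalAt p) g) = RKHS.kerFun A.dBR p g := by
  rw [← szegoCombination_single, compress_szegoCombination, kernelCombination_single]

lemma RightSchur.denseRange_compress (A : RightSchur d H J) : DenseRange A.compress := by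
  refine A.denseRange_kernelCombination.mono ?_
  rintro _ ⟨v, rfl⟩
  exact ⟨_, A.compress_szegoCombination v⟩

lemma RightSchur.norm_sq_compress (A : RightSchur d H J) (x : Fock d J) :
    ‖A.compress x‖ ^ 2 = ‖x‖ ^ 2 - ‖ContinuousLinearMap.adjoint A.op x‖ ^ 2 := by
  refine denseRange_szegoCombination.induction_on x ?_ fun v => ?_
  · exact isClosed_eq (by fun_prop) (by fun_prop)
  · have h := A.inner_kernelCombination v v
    simp only [inner_self_eq_norm_sq_to_K] at h
    rw [compress_szegoCombination]
    exact_mod_cast h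

/-- Evaluations are pairings with kernel vectors, and `compress` matches the two families of kernel
vectors; its adjoint therefore leaves function values unchanged. -/
lemma RightSchur.evalAt_embed (A : RightSchur d H J) (f : A.dBR) (p : KernelIndex d) :
    evalAt p (A.embed f) = f p := by
  refine ext_inner_left ℂ fun g => ?_
  rw [← ContinuousLinearMap.adjoint_inner_left, embed, ContinuousLinearMap.adjoint_inner_right,
    compress_adjoint_evalAt, RKHS.kerFun_inner]

lemma RightSchur.sameFunction_embed (A : RightSchur d H J) (f : A.dBR) :
    A.SameFunction f (A.embed f) := by
  intro n Z
  ext i l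
  rw [← evalAt_std, evalAt_embed]
  rfl

lemma RightSchur.SameFunction.eq_embed {A : RightSchur d H J} {f : A.dBR} {x : Fock d J}
    (h : A.SameFunction f x) : x = A.embed f :=
  Fock.eq_of_fockEval_eq fun n Z => (h n Z).symm.trans (A.sameFunction_embed f n Z)

lemma RightSchur.embed_injective (A : RightSchur d H J) : Function.Injective A.embed := by
  intro f g h
  refine RKHS.ext fun p => ?_
  rw [← evalAt_embed, ← evalAt_embed, h]

lemma RightSchur.value_eq (A : RightSchur d H J) (f : A.dBR) {n : ℕ} (Z : ncBall d n) :
    A.value f Z = fockEval (A.embed f) Z.1 :=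
  A.sameFunction_embed f n Z

lemma RightSchur.adjoint_kernelZero (A : RightSchur d H J) (f : A.dBR) :
    ContinuousLinearMap.adjoint A.kernelZero f = A.embed f 1 := by
  rw [kernelZero, RKHS.adjoint_kerFun, ← evalAt_embed, evalAt_apply]
  have : fockEval (A.embed f) (0 : ncBall d 1).1 0 0 = A.embed f 1 := by
    rw [fockEval_zero_point]
    simp
  simpa using this

/-- This translates Gleason equations into identities in the Fock space. -/
lemma RightSchur.rowValue_add_diagonal (A : RightSchur d H J) (F : A.dBRd) (g : J) {n : ℕ}
    (Z : ncBall d n) :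
    A.rowValue F Z + (Matrix.diagonal fun _ => g) =
      fockEval (rowShift (fun j => A.embed (F j)) g) Z.1 := by
  rw [fockEval_rowShift, rowValue]
  simp only [value_eq]

end Embedding

/-! ### The coisometric colligation -/

section Colligation

variable {d : ℕ} {H J : Type*} [NormedAddCommGroup H] [InnerProductSpace ℂ H] [CompleteSpace H]
  [NormedAddCommGroup J] [InnerProductSpace ℂ J] [CompleteSpace J]

/-- Both `‖z‖²` and `‖A^* z‖²` split by first letter, and `A^*` commutes with the backward shifts.
The constant coefficient of `A^* z` is the one term not absorbed into some `‖Q y_j‖²`. -/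
lemma RightSchur.norm_sq_compress_rowShift (A : RightSchur d H J) (y : Fin d → Fock d J) (g : J) :
    ‖A.compress (rowShift y g)‖ ^ 2 +
        ‖ContinuousLinearMap.adjoint A.op (rowShift y g) 1‖ ^ 2 =
      ∑ j, ‖A.compress (y j)‖ ^ 2 + ‖g‖ ^ 2 := by
  have h1 := norm_sq_eq_sum_leftShiftAdj (rowShift y g)
  have h2 := norm_sq_eq_sum_leftShiftAdj (ContinuousLinearMap.adjoint A.op (rowShift y g))
  simp only [A.leftShiftAdj_adjoint_op, leftShiftAdj_rowShift, rowShift_apply_one] at h1 h2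
  simp only [A.norm_sq_compress, Finset.sum_sub_distrib]
  linarith

/-- The map `(y, g) ↦ ((Q y_j)_j, g)`, where `Q` is `compress`. -/
def RightSchur.colligationSource (A : RightSchur d H J) :
    ((Fin d → Fock d J) × J) →ₗ[ℂ] WithLp 2 (A.dBRd × J) where
  toFun u := WithLp.toLp 2 (WithLp.toLp 2 fun j => A.compress (u.1 j), u.2)
  map_add' u v := by
    exact WithLp.ofLp_injective 2 (Prod.ext (PiLp.ext fun j => by simp) (by simp))
  map_smul' c u := by
    exact WithLp.ofLp_injective 2 (Prod.ext (PiLp.ext fun j => by simp) (by simp))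

/-- The map `(y, g) ↦ (Q z, (A^* z)_∅)` with `z = ∑_j L_j y_j + 1 ⊗ g`, where `Q` is
`compress`. -/
def RightSchur.colligationTarget (A : RightSchur d H J) :
    ((Fin d → Fock d J) × J) →ₗ[ℂ] WithLp 2 (A.dBR × H) where
  toFun u := WithLp.toLp 2 (A.compress (rowShift u.1 u.2),
    ContinuousLinearMap.adjoint A.op (rowShift u.1 u.2) 1)
  map_add' u v := by
    have : rowShift (u + v).1 (u + v).2 = rowShift u.1 u.2 + rowShift v.1 v.2 := by
      simp only [rowShift, vacuum, Prod.fst_add, Prod.snd_add, Pi.add_apply, map_add,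
        Finset.sum_add_distrib, lp.single_add]
      abel
    rw [this]
    exact WithLp.ofLp_injective 2 (Prod.ext (by simp) (by simp))
  map_smul' c u := by
    have : rowShift (c • u).1 (c • u).2 = c • rowShift u.1 u.2 := by
      simp only [rowShift, vacuum, Prod.smul_fst, Prod.smul_snd, Pi.smul_apply, map_smul,
        Finset.smul_sum, lp.single_smul, smul_add]
    rw [this]
    exact WithLp.ofLp_injective 2 (Prod.ext (by simp) (by simp))

/-- The isometry is prescribed only on this range, so density is what defines it everywhere. -/
lemma RightSchur.denseRange_colligationSource (A : RightSchur d H J) :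
    DenseRange A.colligationSource := by
  have h1 : DenseRange (Prod.map (Pi.map fun _ : Fin d => A.compress) (id : J → J)) :=
    (DenseRange.piMap fun _ => A.denseRange_compress).prodMap denseRange_id
  have h2 : DenseRange (fun q : (Fin d → A.dBR) × J =>
      (WithLp.toLp 2 ((WithLp.toLp 2 q.1 : A.dBRd), q.2) : WithLp 2 (A.dBRd × J))) := by
    refine Function.Surjective.denseRange fun q => ?_
    exact ⟨(WithLp.ofLp q.fst, q.snd), rfl⟩
  exact h2.comp h1 (by fun_prop)

lemma RightSchur.norm_colligationTarget (A : RightSchur d H J) (u : (Fin d → Fock d J) × J) :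
    ‖A.colligationTarget u‖ = ‖A.colligationSource u‖ := by
  rw [← sq_eq_sq₀ (norm_nonneg _) (norm_nonneg _), WithLp.prod_norm_sq_eq_of_L2,
    WithLp.prod_norm_sq_eq_of_L2]
  have h := A.norm_sq_compress_rowShift u.1 u.2
  have h1 : ‖(A.colligationSource u).fst‖ ^ 2 = ∑ j, ‖A.compress (u.1 j)‖ ^ 2 :=
    PiLp.norm_sq_eq_of_L2 _ _
  rw [h1]
  exact h

/-- The colligation of `A`: the adjoint of the isometry carrying `((Q y_j)_j, g)` to
`(Q z, (A^* z)_∅)`. -/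
def RightSchur.colligation (A : RightSchur d H J) :
    WithLp 2 (A.dBR × H) →L[ℂ] WithLp 2 (A.dBRd × J) :=
  ContinuousLinearMap.adjoint (A.colligationTarget.extendOfNorm A.colligationSource)

lemma RightSchur.norm_colligation_le (A : RightSchur d H J) (q : WithLp 2 (A.dBR × H)) :
    ‖A.colligation q‖ ≤ ‖q‖ := by
  refine ((A.colligation).le_opNorm q).trans (mul_le_of_le_one_left (norm_nonneg _) ?_)
  rw [colligation, LinearIsometryEquiv.norm_map]
  exact LinearMap.opNorm_extendOfNorm_le A.denseRange_colligationSource zero_le_one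
    fun u => by rw [one_mul, A.norm_colligationTarget]

lemma RightSchur.inner_colligation (A : RightSchur d H J) (u : (Fin d → Fock d J) × J)
    (q : WithLp 2 (A.dBR × H)) :
    ⟪A.colligationSource u, A.colligation q⟫_ℂ = ⟪A.colligationTarget u, q⟫_ℂ := by
  rw [colligation, ContinuousLinearMap.adjoint_inner_right, LinearMap.extendOfNorm_eq
    A.denseRange_colligationSource ⟨1, fun u => by rw [one_mul, A.norm_colligationTarget]⟩]

/-- This is the defining adjoint relation, paired with an arbitrary `z` and moved into the Fock
space through `embed = compress^*`. -/
lemma RightSchur.colligation_eq (A : RightSchur d H J) (q : WithLp 2 (A.dBR × H)) :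
    rowShift (fun j => A.embed ((A.colligation q).fst j)) (A.colligation q).snd =
      A.embed q.fst + A.op (vacuum q.snd) := by
  refine ext_inner_left ℂ fun z => ?_
  -- Every `z` is the row shift of its own coordinates, so these test vectors cover the whole Fock
  -- space.
  have h := A.inner_colligation (fun j => leftShiftAdj j z, z 1) q
  have hT : ⟪A.colligationTarget (fun j => leftShiftAdj j z, z 1), q⟫_ℂ =
      ⟪z, A.embed q.fst + A.op (vacuum q.snd)⟫_ℂ := by
    have : A.colligationTarget (fun j => leftShiftAdj j z, z 1) =
        WithLp.toLp 2 (A.compress z, ContinuousLinearMap.adjoint A.op z 1) := by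
      simp only [colligationTarget, LinearMap.coe_mk, AddHom.coe_mk, rowShift_leftShiftAdj]
    rw [this, WithLp.prod_inner_apply, inner_add_right, embed,
      ContinuousLinearMap.adjoint_inner_right, ← ContinuousLinearMap.adjoint_inner_left A.op]
    congr 1
    -- The constant coefficient of `A^* z` is read off by pairing with the vacuum, which brings `A
    -- (1 ⊗ h)` into the formula.
    rw [← inner_conj_symm, ← inner_vacuum_left, inner_conj_symm]
    rfl
  rw [← hT, ← h, WithLp.prod_inner_apply, ← inner_conj_symm, inner_rowShift, map_add, map_sum,
    PiLp.inner_apply]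
  congr 1
  · refine Finset.sum_congr rfl fun j _ => ?_
    rw [inner_conj_symm, embed, ContinuousLinearMap.adjoint_inner_right]
    rfl
  · rw [inner_conj_symm]
    rfl

end Colligation

/-! ### Gleason solutions -/

section Gleason

lemma adjoint_comp_self_le_id_sub {E F G : Type*} [NormedAddCommGroup E] [InnerProductSpace ℂ E]
    [CompleteSpace E] [NormedAddCommGroup F] [InnerProductSpace ℂ F] [CompleteSpace F]
    [NormedAddCommGroup G] [InnerProductSpace ℂ G] [CompleteSpace G]
    (T : E →L[ℂ] F) (S : E →L[ℂ] G) (h : ∀ x, ‖T x‖ ^ 2 + ‖S x‖ ^ 2 ≤ ‖x‖ ^ 2) :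
    ContinuousLinearMap.adjoint T ∘L T ≤
      ContinuousLinearMap.id ℂ E - ContinuousLinearMap.adjoint S ∘L S := by
  rw [ContinuousLinearMap.le_def, ContinuousLinearMap.isPositive_def']
  refine ⟨?_, fun x => ?_⟩
  · rw [IsSelfAdjoint, ContinuousLinearMap.star_eq_adjoint]
    simp [ContinuousLinearMap.adjoint_comp, ContinuousLinearMap.adjoint_id]
  · simp only [ContinuousLinearMap.reApplyInnerSelf_apply, sub_apply,
      ContinuousLinearMap.comp_apply, ContinuousLinearMap.id_apply, inner_sub_left,
      ContinuousLinearMap.adjoint_inner_left, map_sub, inner_self_eq_norm_sq]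
    linarith [h x]

variable {d : ℕ} {H J : Type*} [NormedAddCommGroup H] [InnerProductSpace ℂ H] [CompleteSpace H]
  [NormedAddCommGroup J] [InnerProductSpace ℂ J] [CompleteSpace J]

/-- The restriction of `L^* ⊗ I` to `𝓗^R(A)`, a corner of the colligation. -/
def RightSchur.shiftRestriction (A : RightSchur d H J) : A.dBR →L[ℂ] A.dBRd :=
  WithLp.fstL 2 ℂ A.dBRd J ∘L A.colligation ∘L
    (WithLp.prodContinuousLinearEquiv 2 ℂ A.dBR H).symm.toContinuousLinearMap ∘L
      ContinuousLinearMap.inl ℂ A.dBR H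

/-- The map `(L^* ⊗ I) A`, a corner of the colligation. -/
def RightSchur.shiftSymbol (A : RightSchur d H J) : H →L[ℂ] A.dBRd :=
  WithLp.fstL 2 ℂ A.dBRd J ∘L A.colligation ∘L
    (WithLp.prodContinuousLinearEquiv 2 ℂ A.dBR H).symm.toContinuousLinearMap ∘L
      ContinuousLinearMap.inr ℂ A.dBR H

lemma RightSchur.embed_colligation (A : RightSchur d H J) (q : WithLp 2 (A.dBR × H)) (j : Fin d) :
    A.embed ((A.colligation q).fst j) =
      leftShiftAdj j (A.embed q.fst + A.op (vacuum q.snd)) := by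
  rw [← colligation_eq, leftShiftAdj_rowShift]

lemma RightSchur.colligation_snd (A : RightSchur d H J) (q : WithLp 2 (A.dBR × H)) :
    (A.colligation q).snd = (A.embed q.fst + A.op (vacuum q.snd)) 1 := by
  rw [← colligation_eq, rowShift_apply_one]

lemma RightSchur.embed_shiftRestriction (A : RightSchur d H J) (f : A.dBR) (j : Fin d) :
    A.embed (A.shiftRestriction f j) = leftShiftAdj j (A.embed f) := by
  refine (A.embed_colligation (WithLp.toLp 2 (f, 0)) j).trans ?_
  simp [vacuum]

lemma RightSchur.embed_shiftSymbol (A : RightSchur d H J) (h : H) (j : Fin d) :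
    A.embed (A.shiftSymbol h j) = leftShiftAdj j (A.op (vacuum h)) := by
  refine (A.embed_colligation (WithLp.toLp 2 (0, h)) j).trans ?_
  simp

/-- Contractivity of the colligation at `(f, 0)`, whose second output is the constant coefficient of
`f`. -/
lemma RightSchur.norm_sq_shiftRestriction_le (A : RightSchur d H J) (f : A.dBR) :
    ‖A.shiftRestriction f‖ ^ 2 + ‖A.embed f 1‖ ^ 2 ≤ ‖f‖ ^ 2 := by
  have h := pow_le_pow_left₀ (norm_nonneg _) (A.norm_colligation_le (WithLp.toLp 2 (f, 0))) 2
  rw [WithLp.prod_norm_sq_eq_of_L2, WithLp.prod_norm_sq_eq_of_L2, colligation_snd] at h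
  simp [vacuum] at h
  exact h

/-- Contractivity at `(0, x)`; the second output is now the constant coefficient of `A (1 ⊗ x)`. -/
lemma RightSchur.norm_sq_shiftSymbol_le (A : RightSchur d H J) (x : H) :
    ‖A.shiftSymbol x‖ ^ 2 + ‖A.zeroValue x‖ ^ 2 ≤ ‖x‖ ^ 2 := by
  have h := pow_le_pow_left₀ (norm_nonneg _) (A.norm_colligation_le (WithLp.toLp 2 (0, x))) 2
  rw [WithLp.prod_norm_sq_eq_of_L2, WithLp.prod_norm_sq_eq_of_L2, colligation_snd] at h
  simp [op_vacuum_apply_one] at h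
  exact h

/-- The free function `Z F(Z) + g` is that of `x` exactly if `F` is the backward shift of `x` and
`g` is its constant coefficient. -/
lemma RightSchur.rowValue_eq_iff (A : RightSchur d H J) (F : A.dBRd) (x : Fock d J) :
    (∀ (n : ℕ) (Z : ncBall d n),
      A.rowValue F Z = fockEval x Z.1 - Matrix.diagonal fun _ => x 1) ↔
      ∀ j, A.embed (F j) = leftShiftAdj j x := by
  simp only [eq_sub_iff_add_eq, rowValue_add_diagonal]
  refine ⟨fun h j => ?_, fun h n Z => ?_⟩
  · rw [← Fock.eq_of_fockEval_eq h, leftShiftAdj_rowShift]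
  · simp only [h, rowShift_leftShiftAdj]

/-- This is `rowValue_eq_iff` at the Fock representative of `f`, whose value at `0ₙ` is its constant
coefficient on the diagonal. -/
lemma RightSchur.isGleasonSpace_iff (A : RightSchur d H J) (X : A.dBR →ₗ[ℂ] A.dBRd) :
    A.IsGleasonSpace X ↔ ∀ f j, A.embed (X f j) = leftShiftAdj j (A.embed f) := by
  simp only [IsGleasonSpace, ← rowValue_eq_iff, value_eq, fockEval_zero_point]

lemma RightSchur.isGleason_iff (A : RightSchur d H J) (Y : H →ₗ[ℂ] A.dBRd) :
    A.IsGleason Y ↔ ∀ h j, A.embed (Y h j) = leftShiftAdj j (A.op (vacuum h)) := by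
  simp only [IsGleason, ← rowValue_eq_iff, fockEval_op_vacuum, op_vacuum_apply_one]

lemma RightSchur.isContractiveGleasonSpace_shiftRestriction (A : RightSchur d H J) :
    A.IsContractiveGleasonSpace A.shiftRestriction := by
  refine ⟨(A.isGleasonSpace_iff _).2 A.embed_shiftRestriction, A.shiftRestriction, rfl, ?_⟩
  have h := adjoint_comp_self_le_id_sub A.shiftRestriction
    (ContinuousLinearMap.adjoint A.kernelZero) fun f => by
      rw [A.adjoint_kernelZero]
      exact A.norm_sq_shiftRestriction_le f
  rwa [ContinuousLinearMap.adjoint_adjoint] at h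

lemma RightSchur.isContractiveGleason_shiftSymbol (A : RightSchur d H J) :
    A.IsContractiveGleason A.shiftSymbol :=
  ⟨(A.isGleason_iff _).2 A.embed_shiftSymbol, A.shiftSymbol, rfl,
    adjoint_comp_self_le_id_sub _ _ A.norm_sq_shiftSymbol_le⟩

lemma RightSchur.isShiftSymbol_shiftSymbol (A : RightSchur d H J) :
    A.IsShiftSymbol A.shiftSymbol := fun h j => by
  rw [← embed_shiftSymbol]
  exact A.sameFunction_embed _

lemma RightSchur.isShiftRestriction_shiftRestriction (A : RightSchur d H J) :
    A.IsShiftRestriction A.shiftRestriction := by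
  refine ⟨fun f => ⟨A.embed f, A.sameFunction_embed f, fun x hx => hx.eq_embed⟩,
    fun f x hx j => ?_⟩
  rw [hx.eq_embed, ← embed_shiftRestriction]
  exact A.sameFunction_embed _

lemma RightSchur.IsGleason.unique {A : RightSchur d H J} {Y Y' : H →ₗ[ℂ] A.dBRd}
    (h : A.IsGleason Y) (h' : A.IsGleason Y') : Y = Y' :=
  LinearMap.ext fun x => PiLp.ext fun j => A.embed_injective
    (((A.isGleason_iff _).1 h x j).trans ((A.isGleason_iff _).1 h' x j).symm)

lemma RightSchur.IsGleasonSpace.unique {A : RightSchur d H J} {X X' : A.dBR →ₗ[ℂ] A.dBRd}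
    (h : A.IsGleasonSpace X) (h' : A.IsGleasonSpace X') : X = X' :=
  LinearMap.ext fun f => PiLp.ext fun j => A.embed_injective
    (((A.isGleasonSpace_iff _).1 h f j).trans ((A.isGleasonSpace_iff _).1 h' f j).symm)

end Gleason

end FreeDBR

end

theorem theorem4p3 {H : Type*} [NormedAddCommGroup H] [InnerProductSpace ℂ H] [CompleteSpace H]
    (d : ℕ) (A : FreeDBR.RightSchur d H H) :
    (∃ Y : H →ₗ[ℂ] A.dBRd, A.IsShiftSymbol Y ∧ A.IsContractiveGleason Y ∧
      ∀ Y' : H →ₗ[ℂ] A.dBRd, A.IsContractiveGleason Y' → Y' = Y) ∧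
    (∃ X : A.dBR →ₗ[ℂ] A.dBRd, A.IsShiftRestriction X ∧ A.IsContractiveGleasonSpace X ∧
      ∀ X' : A.dBR →ₗ[ℂ] A.dBRd, A.IsContractiveGleasonSpace X' → X' = X) :=
  ⟨⟨A.shiftSymbol, A.isShiftSymbol_shiftSymbol, A.isContractiveGleason_shiftSymbol,
      fun _ h => h.1.unique A.isContractiveGleason_shiftSymbol.1⟩,
    ⟨A.shiftRestriction, A.isShiftRestriction_shiftRestriction,
      A.isContractiveGleasonSpace_shiftRestriction,
      fun _ h => h.1.unique A.isContractiveGleasonSpace_shiftRestriction.1⟩⟩
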